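/- Let $k \ge 2$ and $n \ge k+2$ be integers. For a connected simple graph $G$ with finite vertex set $V(G)$, let $D(G)=(d_G(u,v))_{u,v\in V(G)}$ be its distance matrix, let $\mathrm{Tr}(G)$ be the diagonal matrix whose $v$-th diagonal entry is $\sum_{u\in V(G)} d_G(u,v)$, and let the distance signless Laplacian spectral radius $\rho_Q(G)$ be the largest eigenvalue of $Q_D(G)=\mathrm{Tr}(G)+D(G)$. A pendant vertex is a vertex of degree one. For $t_1,t_2\ge 1$ with $t_1+t_2=k$, let $T(n,k;t_1,t_2)$ be the graph of order $n$ obtained from a path of order $n-k$ by attaching $t_1$ pendant edges at one end of the path and $t_2$ pendant edges at the other end, and let $\mathfrak{D}(n,k)=\{T(n,k;t_1,t_2) : t_1,t_2\ge 1,\ t_1+t_2=k\}$. Then $\rho_Q$ attains a maximum over the connected graphs of order $n$ with exactly $k$ pendant vertices, and every graph at which this maximum is attained is isomorphic to a member of $\mathfrak{D}(n,k)$. -/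

import Mathlib

/-- The distance matrix of a graph: the `(u, v)` entry is the distance from `u` to `v`. -/
noncomputable def distanceMatrix {V : Type*} (G : SimpleGraph V) : Matrix V V ℝ :=
  Matrix.of fun u v => (G.dist u v : ℝ)

/-- The transmission of `v`: the sum of the distances from `v` to all the vertices. -/
noncomputable def transmission {V : Type*} [Fintype V] (G : SimpleGraph V) (v : V) : ℝ :=
  ∑ u : V, (G.dist v u : ℝ)

/-- The distance signless Laplacian matrix, the diagonal matrix of the transmissions plus the
distance matrix. -/
noncomputable def distanceSignlessLaplacian {V : Type*} [Fintype V] [DecidableEq V] (G : SimpleGraph V) :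
    Matrix V V ℝ :=
  Matrix.diagonal (transmission G) + distanceMatrix G

/-- The distance signless Laplacian spectral radius: the largest eigenvalue of the distance
signless Laplacian matrix. The lemma `isGreatest_distanceSignlessLaplacianSpectralRadius` below
shows that the supremum is attained. -/
noncomputable def distanceSignlessLaplacianSpectralRadius {V : Type*} [Fintype V] [DecidableEq V]
    (G : SimpleGraph V) : ℝ :=
  sSup {μ : ℝ | Module.End.HasEigenvalue (Matrix.toLin' (distanceSignlessLaplacian G)) μ}

theorem distanceSignlessLaplacian_isHermitian {V : Type*} [Fintype V] [DecidableEq V]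
    (G : SimpleGraph V) : (distanceSignlessLaplacian G).IsHermitian := by
  ext u v
  by_cases h : u = v
  · subst h; simp
  · simp [distanceSignlessLaplacian, distanceMatrix, Matrix.diagonal_apply_ne _ h,
      Matrix.diagonal_apply_ne _ (Ne.symm h), SimpleGraph.dist_comm]

theorem isGreatest_distanceSignlessLaplacianSpectralRadius {V : Type*} [Fintype V]
    [DecidableEq V] [Nonempty V] (G : SimpleGraph V) :
    IsGreatest {μ : ℝ | Module.End.HasEigenvalue
        (Matrix.toLin' (distanceSignlessLaplacian G)) μ}
      (distanceSignlessLaplacianSpectralRadius G) := by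
  have hs : {μ : ℝ | Module.End.HasEigenvalue
      (Matrix.toLin' (distanceSignlessLaplacian G)) μ}
      = spectrum ℝ (distanceSignlessLaplacian G) := by
    ext μ
    rw [Set.mem_ofPred_eq, Module.End.hasEigenvalue_iff_mem_spectrum, Matrix.spectrum_toLin']
  have hr := (distanceSignlessLaplacian_isHermitian G).spectrum_real_eq_range_eigenvalues
  have hfin : {μ : ℝ | Module.End.HasEigenvalue
      (Matrix.toLin' (distanceSignlessLaplacian G)) μ}.Finite := by
    rw [hs, hr]; exact Set.finite_range _
  have hne : {μ : ℝ | Module.End.HasEigenvalue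
      (Matrix.toLin' (distanceSignlessLaplacian G)) μ}.Nonempty := by
    rw [hs, hr]; exact Set.range_nonempty _
  exact ⟨hne.csSup_mem hfin, fun μ hμ => le_csSup hfin.bddAbove hμ⟩

/-- A pendant vertex is a vertex of degree one, that is, with exactly one neighbour. -/
def IsPendantVertex {V : Type*} (G : SimpleGraph V) (v : V) : Prop :=
  ∃! w, G.Adj v w

theorem isPendantVertex_iff_degree_eq_one {V : Type*} (G : SimpleGraph V) (v : V)
    [Fintype (G.neighborSet v)] : IsPendantVertex G v ↔ G.degree v = 1 :=
  SimpleGraph.degree_eq_one_iff_existsUnique_adj.symm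

/-- The class of connected graphs on the vertex set `Fin n` with exactly `k` pendant vertices. -/
def connectedGraphsWithPendant (n k : ℕ) : Set (SimpleGraph (Fin n)) :=
  {G | G.Connected ∧ {v | IsPendantVertex G v}.ncard = k}

/-- The graph obtained from the path with vertices `0, 1, …, ℓ - 1` by attaching `t₁` pendant edges
at its first vertex and `t₂` pendant edges at its last vertex. -/
def doubleBroom (ℓ t₁ t₂ : ℕ) : SimpleGraph (Fin ℓ ⊕ (Fin t₁ ⊕ Fin t₂)) :=
  SimpleGraph.fromRel fun x y =>
    match x, y with
    | .inl i, .inl j => (SimpleGraph.pathGraph ℓ).Adj i j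
    | .inl i, .inr (.inl _) => (i : ℕ) = 0
    | .inl i, .inr (.inr _) => (i : ℕ) + 1 = ℓ
    | .inr _, _ => False

/-- The graphs on `Fin n` isomorphic to some `T(n, k; t₁, t₂)`, i.e. a path of order `ℓ ≥ 2` with
`t₁ ≥ 1` edges attached at one end and `t₂ ≥ 1` at the other, `t₁ + t₂ = k` and `ℓ + k = n`. -/
def doubleBroomClass (n k : ℕ) : Set (SimpleGraph (Fin n)) :=
  {G | ∃ ℓ t₁ t₂ : ℕ, 2 ≤ ℓ ∧ 1 ≤ t₁ ∧ 1 ≤ t₂ ∧ t₁ + t₂ = k ∧ ℓ + k = n ∧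
    Nonempty (G ≃g doubleBroom ℓ t₁ t₂)}

/-! The form `xᵀ Q_D x` is half the sum of `d(u,v) (x_u + x_v)²` over ordered pairs, hence monotone
in every distance. Let `x` be a positive eigenvector for `ρ_Q(G)`. If the average of the distances
in `H` and `K` is at least that in `G`, strictly somewhere, then testing on `x` shows that `H` or
`K` has a larger radius (`spectralRadius_lt_or_lt_of_dist`).

Maximise over connected graphs with at least `k` pendant vertices, a relaxation that tolerates the
new pendant vertices an edge deletion may create. Deleting a non-bridge increases distances, so a
maximiser is a tree. If `w` has distinct neighbours `b`, `c`, `d`, transplant the branch at `b` from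
`w` to `c`, or to `d`: distances grow on average (`two_mul_dist_le_moveEdge`), so one transplant
beats the maximiser and must leave the class. Only the new attachment vertex can cease to be
pendant, so it was pendant and the count was exactly `k`. Hence among any two of three neighbours
one is pendant, which forces a double broom. A count above `k` would exclude degree three, leaving a
path with only two pendant vertices. -/

/-! ### The quadratic form and the spectral radius -/

theorem distanceSignlessLaplacian_mulVec_apply {V : Type*} [Fintype V] [DecidableEq V]
    (G : SimpleGraph V) (x : V → ℝ) (u : V) :
    (distanceSignlessLaplacian G).mulVec x u = ∑ v, (G.dist u v : ℝ) * (x u + x v) := by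
  rw [distanceSignlessLaplacian, Matrix.add_mulVec, Pi.add_apply, Matrix.mulVec_diagonal]
  simp [transmission, Matrix.mulVec, dotProduct, distanceMatrix, mul_add,
    Finset.sum_add_distrib, Finset.sum_mul]

theorem two_mul_dotProduct_distanceSignlessLaplacian_mulVec {V : Type*} [Fintype V]
    [DecidableEq V] (G : SimpleGraph V) (x : V → ℝ) :
    2 * (x ⬝ᵥ (distanceSignlessLaplacian G).mulVec x)
      = ∑ u, ∑ v, (G.dist u v : ℝ) * (x u + x v) ^ 2 := by
  have h : ∑ u, ∑ v, x u * ((G.dist u v : ℝ) * (x u + x v))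
      = ∑ u, ∑ v, x v * ((G.dist u v : ℝ) * (x u + x v)) := by
    rw [Finset.sum_comm]
    refine Finset.sum_congr rfl fun u _ => Finset.sum_congr rfl fun v _ => ?_
    rw [G.dist_comm, add_comm]
  have h' : x ⬝ᵥ (distanceSignlessLaplacian G).mulVec x
      = ∑ u, ∑ v, x u * ((G.dist u v : ℝ) * (x u + x v)) := by
    simp only [dotProduct, distanceSignlessLaplacian_mulVec_apply, Finset.mul_sum]
  rw [two_mul, h']
  nth_rewrite 2 [h]
  simp only [← Finset.sum_add_distrib]
  refine Finset.sum_congr rfl fun u _ => Finset.sum_congr rfl fun v _ => ?_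
  ring

theorem posSemidef_spectralRadius_sub {V : Type*} [Fintype V] [DecidableEq V] [Nonempty V]
    (G : SimpleGraph V) :
    (distanceSignlessLaplacianSpectralRadius G • (1 : Matrix V V ℝ)
      - distanceSignlessLaplacian G).PosSemidef := by
  rw [Matrix.posSemidef_iff_isHermitian_and_spectrum_nonneg]
  refine ⟨Matrix.IsHermitian.sub ?_ (distanceSignlessLaplacian_isHermitian G), ?_⟩
  · ext u v; simp [Matrix.one_apply, eq_comm]
  · intro a ha
    rw [← Algebra.algebraMap_eq_smul_one, ← spectrum.singleton_sub_eq] at ha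
    obtain ⟨μ, hμ, rfl⟩ := by simpa using ha
    have := (isGreatest_distanceSignlessLaplacianSpectralRadius G).2
      (show μ ∈ _ by
      rw [Set.mem_ofPred_eq, Module.End.hasEigenvalue_iff_mem_spectrum, Matrix.spectrum_toLin']
      exact hμ)
    simpa using this

theorem dotProduct_mulVec_le_spectralRadius {V : Type*} [Fintype V] [DecidableEq V] [Nonempty V]
    (G : SimpleGraph V) (x : V → ℝ) :
    x ⬝ᵥ (distanceSignlessLaplacian G).mulVec x
      ≤ distanceSignlessLaplacianSpectralRadius G * (x ⬝ᵥ x) := by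
  have h := (posSemidef_spectralRadius_sub G).re_dotProduct_nonneg x
  simpa [Matrix.sub_mulVec, Matrix.smul_mulVec, dotProduct_sub] using h

/-- A positive semidefinite form vanishes only on its kernel, so equality in the Rayleigh bound
makes `x` an eigenvector (or zero). -/
theorem mulVec_eq_of_dotProduct_mulVec_eq {V : Type*} [Fintype V] [DecidableEq V] [Nonempty V]
    (G : SimpleGraph V) (x : V → ℝ)
    (h : x ⬝ᵥ (distanceSignlessLaplacian G).mulVec x
      = distanceSignlessLaplacianSpectralRadius G * (x ⬝ᵥ x)) :
    (distanceSignlessLaplacian G).mulVec x = distanceSignlessLaplacianSpectralRadius G • x := by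
  have := ((posSemidef_spectralRadius_sub G).dotProduct_mulVec_zero_iff x).1 (by
    simp [Matrix.sub_mulVec, Matrix.smul_mulVec, dotProduct_sub, h])
  simpa [Matrix.sub_mulVec, Matrix.smul_mulVec, sub_eq_zero, eq_comm] using this

/-- The spectral radius of a connected graph has a positive eigenvector. -/
theorem exists_pos_eigenvector {V : Type*} [Fintype V] [DecidableEq V] [Nontrivial V]
    (G : SimpleGraph V) (hG : G.Connected) :
    ∃ x : V → ℝ, (∀ v, 0 < x v) ∧
      (distanceSignlessLaplacian G).mulVec x
        = distanceSignlessLaplacianSpectralRadius G • x := by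
  obtain ⟨x, hx⟩ :=
    (isGreatest_distanceSignlessLaplacianSpectralRadius G).1.exists_hasEigenvector
  have hxe : (distanceSignlessLaplacian G).mulVec x
      = distanceSignlessLaplacianSpectralRadius G • x := by
    simpa using hx.apply_eq_smul
  have habs : (|x|) ⬝ᵥ (|x|) = x ⬝ᵥ x := by simp [dotProduct]
  -- Passing to `|x|` keeps the norm and cannot lower the form, so `|x|` also attains the Rayleigh
  -- bound.
  have hle : x ⬝ᵥ (distanceSignlessLaplacian G).mulVec x
      ≤ (|x|) ⬝ᵥ (distanceSignlessLaplacian G).mulVec (|x|) := by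
    have h : ∑ u, ∑ v, (G.dist u v : ℝ) * (x u + x v) ^ 2
        ≤ ∑ u, ∑ v, (G.dist u v : ℝ) * ((|x|) u + (|x|) v) ^ 2 := by
      refine Finset.sum_le_sum fun u _ => Finset.sum_le_sum fun v _ => ?_
      refine mul_le_mul_of_nonneg_left ?_ (Nat.cast_nonneg _)
      rw [sq_le_sq, Pi.abs_apply, Pi.abs_apply]
      exact (abs_add_le _ _).trans (le_abs_self _)
    rw [← two_mul_dotProduct_distanceSignlessLaplacian_mulVec,
      ← two_mul_dotProduct_distanceSignlessLaplacian_mulVec] at h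
    linarith
  have heq := mulVec_eq_of_dotProduct_mulVec_eq G (|x|) (by
    refine le_antisymm (dotProduct_mulVec_le_spectralRadius G _) ?_
    rw [habs]
    refine le_trans (le_of_eq ?_) hle
    simp [hxe])
  refine ⟨|x|, fun v => ?_, heq⟩
  obtain ⟨w, hw⟩ : ∃ w, x w ≠ 0 := by
    by_contra! h
    exact hx.2 (funext h)
  have hnn : ∀ u, 0 ≤ |x u| := fun u => abs_nonneg _
  refine lt_of_le_of_ne (hnn v) fun h0 => ?_
  -- At a zero of `|x|` the eigenvalue equation equates a sum of nonnegative terms to zero; positive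
  -- distances then make `x` vanish everywhere.
  have hv := congrFun heq v
  rw [distanceSignlessLaplacian_mulVec_apply, Pi.smul_apply, ← h0, smul_zero,
    Finset.sum_eq_zero_iff_of_nonneg (fun u _ =>
      mul_nonneg (Nat.cast_nonneg _) (by simp))] at hv
  have hvw : v ≠ w := by
    rintro rfl
    exact hw (abs_eq_zero.1 h0.symm)
  have := hv w (Finset.mem_univ _)
  have hd := hG.pos_dist_of_ne hvw
  simp [hd.ne', hw] at this

theorem spectralRadius_lt_or_lt_of_dist {V : Type*} [Fintype V] [DecidableEq V] [Nontrivial V]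
    {G H K : SimpleGraph V} (hG : G.Connected)
    (hle : ∀ u v, 2 * G.dist u v ≤ H.dist u v + K.dist u v)
    (hlt : ∃ u v, 2 * G.dist u v < H.dist u v + K.dist u v) :
    distanceSignlessLaplacianSpectralRadius G < distanceSignlessLaplacianSpectralRadius H ∨
      distanceSignlessLaplacianSpectralRadius G < distanceSignlessLaplacianSpectralRadius K := by
  obtain ⟨x, hx, hxe⟩ := exists_pos_eigenvector G hG
  have h : ∑ u, ∑ v, 2 * ((G.dist u v : ℝ) * (x u + x v) ^ 2)
      < ∑ u, ∑ v, ((H.dist u v : ℝ) * (x u + x v) ^ 2 + (K.dist u v : ℝ) * (x u + x v) ^ 2) := by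
    have key : ∀ u v, 2 * ((G.dist u v : ℝ) * (x u + x v) ^ 2)
        ≤ (H.dist u v : ℝ) * (x u + x v) ^ 2 + (K.dist u v : ℝ) * (x u + x v) ^ 2 := by
      intro u v
      rw [← add_mul, ← mul_assoc]
      exact mul_le_mul_of_nonneg_right (by exact_mod_cast hle u v) (sq_nonneg _)
    obtain ⟨a, b, hab⟩ := hlt
    refine Finset.sum_lt_sum (fun u _ => Finset.sum_le_sum fun v _ => key u v)
      ⟨a, Finset.mem_univ _, Finset.sum_lt_sum (fun v _ => key a v) ⟨b, Finset.mem_univ _, ?_⟩⟩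
    rw [← add_mul, ← mul_assoc]
    exact mul_lt_mul_of_pos_right (by exact_mod_cast hab) (pow_pos (add_pos (hx a) (hx b)) 2)
  simp only [Finset.sum_add_distrib, ← Finset.mul_sum,
    ← two_mul_dotProduct_distanceSignlessLaplacian_mulVec] at h
  have hH := dotProduct_mulVec_le_spectralRadius H x
  have hK := dotProduct_mulVec_le_spectralRadius K x
  rw [hxe, dotProduct_smul, smul_eq_mul] at h
  have hxx : 0 ≤ x ⬝ᵥ x := Finset.sum_nonneg fun v _ => mul_self_nonneg _
  by_contra! hcon
  have h1 := mul_le_mul_of_nonneg_right hcon.1 hxx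
  have h2 := mul_le_mul_of_nonneg_right hcon.2 hxx
  linarith

/-! ### Distances in trees and moving an edge -/

namespace SimpleGraph

variable {V : Type*} {G : SimpleGraph V}

/-- In a tree at most one neighbour of `w` is closer to `u` than `w` is. -/
theorem IsTree.eq_of_dist_add_one_eq (hG : G.IsTree) {u w a b : V} (ha : G.Adj w a)
    (hb : G.Adj w b) (hda : G.dist w u = G.dist a u + 1) (hdb : G.dist w u = G.dist b u + 1) :
    a = b := by
  obtain ⟨p, hp⟩ := hG.connected.exists_walk_length_eq_dist a u
  obtain ⟨q, hq⟩ := hG.connected.exists_walk_length_eq_dist b u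
  have hp' : (Walk.cons ha p).IsPath := Walk.isPath_of_length_eq_dist _ (by simp [hp, hda])
  have hq' : (Walk.cons hb q).IsPath := Walk.isPath_of_length_eq_dist _ (by simp [hq, hdb])
  have h := (hG.existsUnique_path w u).unique hp' hq'
  simpa using congrArg Walk.snd h

/-- Convexity of the distance in a tree: at most one neighbour of `w` is a step closer to `u`, and
every other one is a step further. -/
theorem IsTree.two_mul_dist_le (hG : G.IsTree) {w a b : V} (ha : G.Adj w a)
    (hb : G.Adj w b) (hab : a ≠ b) (u : V) :
    2 * G.dist w u ≤ G.dist a u + G.dist b u := by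
  have h1 := hG.dist_eq_dist_add_one_of_adj u ha
  have h2 := hG.dist_eq_dist_add_one_of_adj u hb
  have h3 := hG.eq_of_dist_add_one_eq (u := u) ha hb
  rw [G.dist_comm (u := w), G.dist_comm (u := a), G.dist_comm (u := b)] at *
  by_contra hcon
  exact hab (h3 (by omega) (by omega))

/-- A function varying by at most one along each edge is a lower bound for distances. -/
theorem Connected.sub_le_dist (hG : G.Connected) (f : V → ℤ)
    (hf : ∀ a b, G.Adj a b → f b ≤ f a + 1) (u v : V) : f v - f u ≤ G.dist u v := by
  obtain ⟨p, hp⟩ := hG.exists_walk_length_eq_dist u v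
  rw [← hp]
  clear hp
  induction p with
  | nil => simp
  | cons h p ih =>
    have := hf _ _ h
    simp only [Walk.length_cons, Nat.cast_add, Nat.cast_one]
    omega

theorem Connected.dist_le_dist_add_one (hG : G.Connected) (u : V) {a b : V} (h : G.Adj a b) :
    G.dist u b ≤ G.dist u a + 1 := by
  have := hG.dist_triangle (u := u) (v := a) (w := b)
  rwa [dist_eq_one_iff_adj.2 h] at this

/-- The graph obtained by detaching the edge `wb` at `w` and attaching it at `c` instead. -/
def moveEdge (G : SimpleGraph V) (w b c : V) : SimpleGraph V :=
  G.deleteEdges {s(w, b)} ⊔ edge c b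

theorem moveEdge_adj {w b c x y : V} : (G.moveEdge w b c).Adj x y ↔
    (G.Adj x y ∧ s(x, y) ≠ s(w, b)) ∨ ((x = c ∧ y = b ∨ x = b ∧ y = c) ∧ x ≠ y) := by
  simp [moveEdge, edge_adj]

theorem Reachable.of_forall_adj {H : SimpleGraph V} (h : ∀ a b, G.Adj a b → H.Reachable a b)
    {u v : V} (huv : G.Reachable u v) : H.Reachable u v := by
  obtain ⟨p⟩ := huv
  induction p with
  | nil => rfl
  | cons ha _ ih => exact (h _ _ ha).trans ih

theorem Connected.moveEdge (hG : G.Connected) {w b c : V} (hc : G.Adj w c) (hbc : b ≠ c) :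
    (G.moveEdge w b c).Connected := by
  have := hG.nonempty
  have hwb : (G.moveEdge w b c).Reachable w b := by
    refine Reachable.trans (v := c) (Adj.reachable ?_) (Adj.reachable ?_)
    · rw [moveEdge_adj]
      refine Or.inl ⟨hc, ?_⟩
      simp [hbc.symm, hc.ne']
    · rw [moveEdge_adj]
      exact Or.inr ⟨Or.inl ⟨rfl, rfl⟩, hbc.symm⟩
  refine ⟨fun u v => (hG u v).of_forall_adj fun x y hxy => ?_⟩
  by_cases h : s(x, y) = s(w, b)
  · obtain ⟨rfl, rfl⟩ | ⟨rfl, rfl⟩ := Sym2.eq_iff.1 h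
    · exact hwb
    · exact hwb.symm
  · exact (moveEdge_adj.2 (Or.inl ⟨hxy, h⟩)).reachable

section

variable {w b c : V}

/-- The vertices on the side of `b` when the edge `wb` is deleted. -/
def branch (G : SimpleGraph V) (w b : V) : Set V :=
  {z | (G.deleteEdges {s(w, b)}).Reachable z b}

theorem self_mem_branch : b ∈ G.branch w b := Reachable.refl b

theorem mem_branch_congr {x y : V} (h : G.Adj x y) (hne : s(x, y) ≠ s(w, b)) :
    x ∈ G.branch w b ↔ y ∈ G.branch w b := by
  have : (G.deleteEdges {s(w, b)}).Adj x y := by simp [h, hne]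
  exact ⟨fun hx => this.symm.reachable.trans hx, fun hy => this.reachable.trans hy⟩

theorem IsAcyclic.notMem_branch (hG : G.IsAcyclic) (hb : G.Adj w b) : w ∉ G.branch w b :=
  isBridge_iff.1 (isAcyclic_iff_forall_adj_isBridge.1 hG hb)

theorem IsAcyclic.neighbor_notMem_branch (hG : G.IsAcyclic) (hb : G.Adj w b) (hc : G.Adj w c)
    (hbc : b ≠ c) : c ∉ G.branch w b := by
  rw [← mem_branch_congr hc (by simp [hbc.symm, hc.ne'])]
  exact hG.notMem_branch hb

theorem moveEdge_adj_cases {x y : V} (h : (G.moveEdge w b c).Adj x y) :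
    (G.Adj x y ∧ (x ∈ G.branch w b ↔ y ∈ G.branch w b)) ∨
      (x = c ∧ y = b ∨ x = b ∧ y = c) := by
  rcases moveEdge_adj.1 h with ⟨h1, h2⟩ | ⟨h1, -⟩
  · exact Or.inl ⟨h1, mem_branch_congr h1 h2⟩
  · exact Or.inr h1

open Classical in
/-- Distances within the two sides of `wb` do not decrease when the edge is moved. -/
theorem IsTree.dist_le_dist_moveEdge (hG : G.IsTree) (hb : G.Adj w b) (hc : G.Adj w c)
    (hbc : b ≠ c) {u v : V} (huv : u ∈ G.branch w b ↔ v ∈ G.branch w b) :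
    G.dist u v ≤ (G.moveEdge w b c).dist u v := by
  have hcB := hG.isAcyclic.neighbor_notMem_branch hb hc hbc
  have hH := hG.connected.moveEdge (b := b) hc hbc
  have hbB : b ∈ G.branch w b := self_mem_branch
  have hl := fun {x y : V} (h : G.Adj x y) => hG.connected.dist_le_dist_add_one u h
  -- The test function is the distance from `u` on the side of `u`, and on the other side the
  -- constant equal to its value at the near end of the new edge `cb`.
  have h := hH.sub_le_dist
    (fun z => if (z ∈ G.branch w b ↔ u ∈ G.branch w b) then (G.dist u z : ℤ)
      else if u ∈ G.branch w b then (G.dist u b : ℤ) else (G.dist u c : ℤ)) ?_ u v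
  · simp only [huv.symm, iff_self, if_true, dist_self] at h
    push_cast at h
    omega
  · intro x y hxy
    rcases moveEdge_adj_cases hxy with ⟨h1, h2⟩ | ⟨rfl, rfl⟩ | ⟨rfl, rfl⟩
    · have := hl h1
      simp only [h2]
      split_ifs <;> omega
    · by_cases hu : u ∈ G.branch w y <;> simp [hu, hbB, hcB]
    · by_cases hu : u ∈ G.branch w x <;> simp [hu, hbB, hcB]

open Classical in
/-- A lower bound for the distance between the two sides once the edge `wb` is moved. -/
theorem IsTree.dist_add_one_add_dist_le_moveEdge (hG : G.IsTree) (hb : G.Adj w b)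
    (hc : G.Adj w c) (hbc : b ≠ c) {u v : V} (hu : u ∉ G.branch w b) (hv : v ∈ G.branch w b) :
    G.dist c u + 1 + G.dist b v ≤ (G.moveEdge w b c).dist u v := by
  have hcB := hG.isAcyclic.neighbor_notMem_branch hb hc hbc
  have hH := hG.connected.moveEdge (b := b) hc hbc
  have hbB : b ∈ G.branch w b := self_mem_branch
  -- A signed distance across the new edge, with value `0` at `c` and `1` at `b`.
  have h := hH.sub_le_dist
    (fun z => if z ∈ G.branch w b then (1 + G.dist b z : ℤ) else - (G.dist c z : ℤ)) ?_ u v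
  · simp only [hu, hv, if_true, if_false] at h
    omega
  · intro x y hxy
    rcases moveEdge_adj_cases hxy with ⟨h1, h2⟩ | ⟨rfl, rfl⟩ | ⟨rfl, rfl⟩
    · have := hG.connected.dist_le_dist_add_one b h1
      have := hG.connected.dist_le_dist_add_one c h1.symm
      simp only [h2]
      split_ifs <;> omega
    · simp [hbB, hcB]
    · simp [hbB, hcB]

/-- Moving an edge `wb` of a tree to one of two other neighbours of `w` increases each distance
on average. -/
theorem IsTree.two_mul_dist_le_moveEdge (hG : G.IsTree) {d : V} (hb : G.Adj w b)
    (hc : G.Adj w c) (hd : G.Adj w d) (hbc : b ≠ c) (hbd : b ≠ d) (hcd : c ≠ d) (u v : V) :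
    2 * G.dist u v ≤ (G.moveEdge w b c).dist u v + (G.moveEdge w b d).dist u v := by
  have key : ∀ u v, u ∉ G.branch w b → v ∈ G.branch w b →
      2 * G.dist u v ≤ (G.moveEdge w b c).dist u v + (G.moveEdge w b d).dist u v := by
    intro u v hu hv
    -- The old distance is at most `d(w,u) + 1 + d(b,v)`; convexity bounds `2 d(w,u)` by `d(c,u) +
    -- d(d,u)`.
    have h1 := hG.dist_add_one_add_dist_le_moveEdge hb hc hbc hu hv
    have h2 := hG.dist_add_one_add_dist_le_moveEdge hb hd hbd hu hv
    have h3 := hG.two_mul_dist_le hc hd hcd u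
    have h4 := hG.connected.dist_triangle (u := u) (v := w) (w := v)
    have h5 := hG.connected.dist_triangle (u := w) (v := b) (w := v)
    rw [dist_eq_one_iff_adj.2 hb] at h5
    rw [G.dist_comm (u := u) (v := w)] at h4
    omega
  by_cases hu : u ∈ G.branch w b <;> by_cases hv : v ∈ G.branch w b
  · have h1 := hG.dist_le_dist_moveEdge hb hc hbc (iff_of_true hu hv)
    have h2 := hG.dist_le_dist_moveEdge hb hd hbd (iff_of_true hu hv)
    omega
  · have := key v u hv hu
    simpa only [dist_comm (u := u) (v := v)] using this
  · exact key u v hu hv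
  · have h1 := hG.dist_le_dist_moveEdge hb hc hbc (iff_of_false hu hv)
    have h2 := hG.dist_le_dist_moveEdge hb hd hbd (iff_of_false hu hv)
    omega

theorem IsTree.two_mul_dist_lt_moveEdge (hG : G.IsTree) {d : V} (hb : G.Adj w b)
    (hc : G.Adj w c) (hd : G.Adj w d) (hbc : b ≠ c) (hbd : b ≠ d) :
    2 * G.dist w b < (G.moveEdge w b c).dist w b + (G.moveEdge w b d).dist w b := by
  have hw := hG.isAcyclic.notMem_branch hb
  have h1 := hG.dist_add_one_add_dist_le_moveEdge hb hc hbc hw self_mem_branch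
  have h2 := hG.dist_add_one_add_dist_le_moveEdge hb hd hbd hw self_mem_branch
  rw [dist_eq_one_iff_adj.2 hc.symm] at h1
  rw [dist_eq_one_iff_adj.2 hd.symm] at h2
  rw [dist_eq_one_iff_adj.2 hb]
  simp only [dist_self] at h1 h2
  omega

/-- Moving the edge `wb` to `c` keeps all the pendant vertices other than `c`, provided that `w`
keeps two neighbours. -/
theorem isPendantVertex_moveEdge {d z : V} (hb : G.Adj w b) (hc : G.Adj w c) (hd : G.Adj w d)
    (hbc : b ≠ c) (hcd : c ≠ d) (hz : IsPendantVertex G z) (hzc : z ≠ c) :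
    IsPendantVertex (G.moveEdge w b c) z := by
  obtain ⟨y, hy, huniq⟩ := hz
  have hzw : z ≠ w := by
    rintro rfl
    exact hcd ((huniq c hc).trans (huniq d hd).symm)
  by_cases hzb : z = b
  · subst hzb
    refine ⟨c, moveEdge_adj.2 (Or.inr ⟨Or.inr ⟨rfl, rfl⟩, hbc⟩), fun a ha => ?_⟩
    rcases moveEdge_adj.1 ha with ⟨h1, h2⟩ | ⟨⟨h1, -⟩ | ⟨-, h1⟩, -⟩
    · refine absurd ?_ h2
      rw [huniq a h1, ← huniq w hb.symm, Sym2.eq_swap]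
    · exact absurd h1 hzc
    · exact h1
  · refine ⟨y, moveEdge_adj.2 (Or.inl ⟨hy, by simp [hzw, hzb]⟩), fun a ha => ?_⟩
    rcases moveEdge_adj.1 ha with ⟨h1, -⟩ | ⟨⟨h1, -⟩ | ⟨h1, -⟩, -⟩
    · exact huniq a h1
    · exact absurd h1 hzc
    · exact absurd h1 hzb

end

/-- A vertex of a tree that is not pendant has a neighbour further away from a given vertex. -/
theorem IsTree.exists_dist_eq_add_one (hG : G.IsTree) {x y : V} (hxy : x ≠ y)
    (hx : ¬ IsPendantVertex G x) : ∃ z, G.Adj x z ∧ G.dist z y = G.dist x y + 1 := by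
  have : Nontrivial V := ⟨x, y, hxy⟩
  obtain ⟨a, ha⟩ := hG.connected.preconnected.exists_adj_of_nontrivial x
  obtain ⟨b, hb, hba⟩ : ∃ b, G.Adj x b ∧ b ≠ a := by
    by_contra! h
    exact hx ⟨a, ha, h⟩
  have h1 := hG.two_mul_dist_le ha hb hba.symm y
  have h2 := hG.dist_eq_dist_add_one_of_adj y ha
  have h3 := hG.dist_eq_dist_add_one_of_adj y hb
  rw [G.dist_comm (u := y), G.dist_comm (u := y)] at h2 h3
  by_cases h : G.dist a y = G.dist x y + 1
  · exact ⟨a, ha, h⟩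
  · exact ⟨b, hb, by omega⟩

/-- A tree whose vertices have at most two neighbours has at most two pendant vertices. -/
theorem IsTree.ncard_isPendantVertex_le_two [Finite V] [Nontrivial V] (hG : G.IsTree)
    (h : ∀ w a b c, G.Adj w a → G.Adj w b → G.Adj w c → a = b ∨ a = c ∨ b = c) :
    {v | IsPendantVertex G v}.ncard ≤ 2 := by
  classical
  have := Fintype.ofFinite V
  have h1 := hG.card_edgeFinset
  have h2 := G.sum_degrees_eq_twice_card_edges
  have hset : {v | IsPendantVertex G v} = ((Finset.univ.filter fun v => G.degree v = 1 :
      Finset V) : Set V) := by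
    ext v
    simp [isPendantVertex_iff_degree_eq_one]
  rw [hset, Set.ncard_coe_finset, Finset.card_filter]
  -- Summed over the vertices, this is compared with the degree sum `2(|V| - 1)` of a tree.
  have hd : ∀ v, G.degree v + (if G.degree v = 1 then 1 else 0) ≤ 2 := by
    intro v
    have : G.degree v ≤ 2 := by
      by_contra! hlt
      obtain ⟨a, b, c, ha, hb, hc, hab, hac, hbc⟩ := Finset.two_lt_card_iff.1 hlt
      simp only [mem_neighborFinset] at ha hb hc
      rcases h v a b c ha hb hc with h | h | h
      exacts [hab h, hac h, hbc h]
    split_ifs <;> omega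
  have h3 : ∑ v, G.degree v + ∑ v, (if G.degree v = 1 then 1 else 0) ≤ ∑ v : V, 2 := by
    rw [← Finset.sum_add_distrib]
    exact Finset.sum_le_sum fun v _ => hd v
  have h4 : ∑ v : V, 2 = 2 * Fintype.card V := by simp [mul_comm]
  have h5 : 2 ≤ Fintype.card V := Fintype.one_lt_card
  omega

theorem isPendantVertex_deleteEdges [Nontrivial V] {e : Set (Sym2 V)}
    (hG : (G.deleteEdges e).Connected) {v : V} (hv : IsPendantVertex G v) :
    IsPendantVertex (G.deleteEdges e) v := by
  obtain ⟨a, ha⟩ := hG.preconnected.exists_adj_of_nontrivial v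
  obtain ⟨y, -, huniq⟩ := hv
  have hle := G.deleteEdges_le e
  exact ⟨a, ha, fun b hb => (huniq b (hle hb)).trans (huniq a (hle ha)).symm⟩

end SimpleGraph

/-! ### Recognising double brooms -/

namespace SimpleGraph

variable {V : Type*} {G : SimpleGraph V}

theorem Connected.exists_geodesic (hG : G.Connected) (u v : V) :
    ∃ f : ℕ → V, f 0 = u ∧ f (G.dist u v) = v ∧
      ∀ i j, i ≤ j → j ≤ G.dist u v → G.dist (f i) (f j) = j - i := by
  obtain ⟨p, hp⟩ := hG.exists_walk_length_eq_dist u v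
  have hle : ∀ i k, i + k ≤ p.length → G.dist (p.getVert i) (p.getVert (i + k)) ≤ k := by
    intro i k
    induction k with
    | zero => simp
    | succ k ih =>
      intro hk
      have h1 := ih (by omega)
      have h2 := hG.dist_le_dist_add_one (p.getVert i)
        (p.adj_getVert_succ (i := i + k) (by omega))
      rw [← add_assoc]
      omega
  refine ⟨p.getVert, by simp, by rw [← hp]; simp, fun i j hij hj => ?_⟩
  rw [← hp] at hj
  obtain ⟨k, rfl⟩ := Nat.exists_eq_add_of_le hij
  have h1 := hle 0 i (by omega)
  have h2 := hle i k hj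
  have h3 := hle (i + k) (p.length - (i + k)) (by omega)
  rw [Nat.add_sub_cancel' hj, Walk.getVert_length] at h3
  rw [zero_add, Walk.getVert_zero] at h1
  have h4 := hG.dist_triangle (u := u) (v := p.getVert i) (w := v)
  have h5 := hG.dist_triangle (u := p.getVert i) (v := p.getVert (i + k)) (w := v)
  omega

theorem Connected.forall_of_adj (hG : G.Connected) {P : V → Prop}
    (hP : ∀ a b, G.Adj a b → P a → P b) {u : V} (hu : P u) (v : V) : P v := by
  obtain ⟨p⟩ := hG u v
  induction p with
  | nil => exact hu
  | cons h _ ih => exact ih (hP _ _ h hu)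

/-- A tree with two vertices that are not pendant, in which each vertex with three neighbours has
at most one neighbour that is not pendant, is a double broom. -/
theorem IsTree.exists_iso_doubleBroom [Finite V] (hG : G.IsTree)
    (hstar : ∀ w b c d, G.Adj w b → G.Adj w c → G.Adj w d → b ≠ c → b ≠ d → c ≠ d →
      IsPendantVertex G c ∨ IsPendantVertex G d)
    {x y : V} (hxy : x ≠ y) (hx : ¬ IsPendantVertex G x) (hy : ¬ IsPendantVertex G y) :
    ∃ ℓ t₁ t₂ : ℕ, 2 ≤ ℓ ∧ 1 ≤ t₁ ∧ 1 ≤ t₂ ∧ t₁ + t₂ = {v | IsPendantVertex G v}.ncard ∧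
      ℓ + {v | IsPendantVertex G v}.ncard = Nat.card V ∧
      Nonempty (G ≃g doubleBroom ℓ t₁ t₂) := by
  have : Nonempty (V × V) := ⟨(x, y)⟩
  obtain ⟨⟨u, v⟩, huv⟩ := Finite.exists_max fun q : V × V => G.dist q.1 q.2
  replace huv : ∀ a b, G.dist a b ≤ G.dist u v := fun a b => huv (a, b)
  -- The segment from `x` to `y` extends by one edge beyond each end.
  have hm : 3 ≤ G.dist u v := by
    obtain ⟨x', hx', hdx⟩ := hG.exists_dist_eq_add_one hxy hx
    have hne : y ≠ x' := by
      rintro rfl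
      simp at hdx
    obtain ⟨y', hy', hdy⟩ := hG.exists_dist_eq_add_one hne hy
    have h1 := huv y' x'
    have h2 := hG.connected.pos_dist_of_ne hxy
    rw [G.dist_comm (u := y) (v := x')] at hdy
    omega
  have huv' : u ≠ v := by
    rintro rfl
    simp at hm
  have hpu : IsPendantVertex G u := by
    by_contra h
    obtain ⟨z, -, hz⟩ := hG.exists_dist_eq_add_one huv' h
    have := huv z v
    omega
  have hpv : IsPendantVertex G v := by
    by_contra h
    obtain ⟨z, -, hz⟩ := hG.exists_dist_eq_add_one huv'.symm h
    have := huv z u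
    rw [G.dist_comm (u := v) (v := u)] at hz
    omega
  obtain ⟨f, hf0, hfm, hf⟩ := hG.connected.exists_geodesic u v
  generalize G.dist u v = m at hm hfm hf huv
  have hinj : ∀ i j, i ≤ m → j ≤ m → f i = f j → i = j := by
    intro i j hi hj hij
    rcases le_total i j with h | h
    · have := hf i j h hj
      rw [hij, dist_self] at this
      omega
    · have := hf j i h hi
      rw [hij, dist_self] at this
      omega
  have hadj : ∀ i j, i ≤ m → j ≤ m → (G.Adj (f i) (f j) ↔ i + 1 = j ∨ j + 1 = i) := by
    intro i j hi hj
    rw [← dist_eq_one_iff_adj]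
    rcases le_total i j with h | h
    · rw [hf i j h hj]
      omega
    · rw [dist_comm, hf j i h hi]
      omega
  have hnp : ∀ i, 1 ≤ i → i < m → ¬ IsPendantVertex G (f i) := by
    rintro i hi him ⟨a, -, ha⟩
    have h1 := ha (f (i - 1)) ((hadj _ _ (by omega) (by omega)).2 (by omega))
    have h2 := ha (f (i + 1)) ((hadj _ _ (by omega) (by omega)).2 (by omega))
    have := hinj _ _ (by omega) (by omega) (h1.trans h2.symm)
    omega
  -- The set described is closed under adjacency, hence everything.
  have hcover : ∀ z, (∃ i, 1 ≤ i ∧ i < m ∧ f i = z) ∨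
      (IsPendantVertex G z ∧ G.Adj z (f 1)) ∨ (IsPendantVertex G z ∧ G.Adj z (f (m - 1))) := by
    refine hG.connected.forall_of_adj ?_ (u := f 1) (Or.inl ⟨1, le_rfl, by omega, rfl⟩)
    rintro a b hab (⟨i, hi, him, rfl⟩ | ⟨ha, ha1⟩ | ⟨ha, ha1⟩)
    · have hl : G.Adj (f i) (f (i - 1)) := (hadj _ _ (by omega) (by omega)).2 (by omega)
      have hr : G.Adj (f i) (f (i + 1)) := (hadj _ _ (by omega) (by omega)).2 (by omega)
      by_cases hbl : b = f (i - 1)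
      · subst hbl
        by_cases h1 : i = 1
        · subst h1
          exact Or.inr (Or.inl ⟨by simpa [hf0] using hpu, hab.symm⟩)
        · exact Or.inl ⟨i - 1, by omega, by omega, rfl⟩
      by_cases hbr : b = f (i + 1)
      · subst hbr
        by_cases h1 : i + 1 = m
        · obtain rfl : i = m - 1 := by omega
          exact Or.inr (Or.inr ⟨by rw [h1, hfm]; exact hpv, hab.symm⟩)
        · exact Or.inl ⟨i + 1, by omega, by omega, rfl⟩
      have hlr : f (i - 1) ≠ f (i + 1) := fun h => by
        have := hinj _ _ (by omega) (by omega) h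
        omega
      have hl1 : IsPendantVertex G (f (i - 1)) → i = 1 := fun h => by
        by_contra h1
        exact hnp _ (by omega) (by omega) h
      have hr1 : IsPendantVertex G (f (i + 1)) → i = m - 1 := fun h => by
        by_contra h1
        exact hnp _ (by omega) (by omega) h
      -- If `b` off the path were not pendant, both path neighbours of `f i` would be, giving `i = 1
      -- = m - 1` against `m ≥ 3`.
      have hb : IsPendantVertex G b := by
        by_contra hb
        have h1 := (hstar _ _ _ _ hr hab hl (Ne.symm hbr) hlr.symm hbl).resolve_left hb
        have h2 := (hstar _ _ _ _ hl hab hr (Ne.symm hbl) hlr hbr).resolve_left hb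
        have := hl1 h1
        have := hr1 h2
        omega
      rcases hstar _ _ _ _ hab hl hr hbl hbr hlr with h | h
      · obtain rfl := hl1 h
        exact Or.inr (Or.inl ⟨hb, hab.symm⟩)
      · obtain rfl := hr1 h
        exact Or.inr (Or.inr ⟨hb, hab.symm⟩)
    · exact Or.inl ⟨1, le_rfl, by omega, ha.unique ha1 hab⟩
    · exact Or.inl ⟨m - 1, by omega, by omega, ha.unique ha1 hab⟩
  let A := {z // IsPendantVertex G z ∧ G.Adj z (f 1)}
  let C := {z // IsPendantVertex G z ∧ G.Adj z (f (m - 1))}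
  let eA : Fin (Nat.card A) ≃ A := (Finite.equivFin A).symm
  let eC : Fin (Nat.card C) ≃ C := (Finite.equivFin C).symm
  -- The spine is `f 1, …, f (m - 1)`: the diametral ends `f 0` and `f m` are leaves, counted in `A`
  -- and `C`.
  let g : Fin (m - 1) ⊕ (Fin (Nat.card A) ⊕ Fin (Nat.card C)) → V :=
    Sum.elim (fun i => f (i + 1)) (Sum.elim (fun a => (eA a).1) (fun c => (eC c).1))
  have hg1 : ∀ i, g (.inl i) = f (i + 1) := fun _ => rfl
  have hg2 : ∀ a, g (.inr (.inl a)) = (eA a).1 := fun _ => rfl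
  have hg3 : ∀ a, g (.inr (.inr a)) = (eC a).1 := fun _ => rfl
  have hpend : ∀ s, IsPendantVertex G (g (.inr s)) := by
    rintro (a | a)
    · exact (eA a).2.1
    · exact (eC a).2.1
  have hpath : ∀ i, ¬ IsPendantVertex G (g (.inl i)) := fun i => hnp _ (by omega) (by omega)
  have hAadj : ∀ a z, G.Adj (g (.inr (.inl a))) z ↔ z = f 1 := fun a z =>
    ⟨fun h => (eA a).2.1.unique h (eA a).2.2, fun h => h ▸ (eA a).2.2⟩
  have hCadj : ∀ a z, G.Adj (g (.inr (.inr a))) z ↔ z = f (m - 1) := fun a z =>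
    ⟨fun h => (eC a).2.1.unique h (eC a).2.2, fun h => h ▸ (eC a).2.2⟩
  have h1m : f 1 ≠ f (m - 1) := fun h => by
    have := hinj _ _ (by omega) (by omega) h
    omega
  have hginj : Function.Injective g := by
    rintro (i | s) (j | t) h
    · have := hinj _ _ (by omega) (by omega) h
      congr 1
      ext
      omega
    · exact absurd (h ▸ hpend t) (hpath i)
    · exact absurd (h ▸ hpend s) (hpath j)
    · rcases s with a | a <;> rcases t with b | b
      · rw [eA.injective (Subtype.ext h)]
      · refine absurd ?_ h1m
        rw [← hCadj b, ← h, hAadj]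
      · refine absurd ?_ h1m
        rw [← hCadj a, h, hAadj]
      · rw [eC.injective (Subtype.ext h)]
  have hgsurj : Function.Surjective g := by
    intro z
    rcases hcover z with ⟨i, hi, him, rfl⟩ | hz | hz
    · refine ⟨.inl ⟨i - 1, by omega⟩, ?_⟩
      rw [hg1, Nat.sub_add_cancel hi]
    · exact ⟨.inr (.inl (eA.symm ⟨z, hz⟩)), by simp [hg2]⟩
    · exact ⟨.inr (.inr (eC.symm ⟨z, hz⟩)), by simp [hg3]⟩
  have hcount : {v | IsPendantVertex G v}.ncard = Nat.card A + Nat.card C := by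
    have : {v | IsPendantVertex G v} = Set.range (g ∘ Sum.inr) := by
      ext z
      constructor
      · intro hz
        obtain ⟨i | s, rfl⟩ := hgsurj z
        · exact absurd hz (hpath i)
        · exact ⟨s, rfl⟩
      · rintro ⟨s, rfl⟩
        exact hpend s
    rw [this, ← Nat.card_coe_set_eq,
      Nat.card_range_of_injective (hginj.comp Sum.inr_injective)]
    simp
  have hcard : m - 1 + (Nat.card A + Nat.card C) = Nat.card V := by
    rw [← Nat.card_congr (Equiv.ofBijective g ⟨hginj, hgsurj⟩)]
    simp
  have hiso : ∀ s t, G.Adj (g s) (g t) ↔ (doubleBroom (m - 1) (Nat.card A) (Nat.card C)).Adj s t := by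
    have hf1 : ∀ i : Fin (m - 1), f (i + 1) = f 1 ↔ (i : ℕ) = 0 := fun i =>
      ⟨fun h => by have := hinj _ _ (by omega) (by omega) h; omega, fun h => by rw [h]⟩
    have hfm1 : ∀ i : Fin (m - 1), f (i + 1) = f (m - 1) ↔ (i : ℕ) + 1 = m - 1 := fun i =>
      ⟨fun h => hinj _ _ (by omega) (by omega) h, fun h => by rw [h]⟩
    have hlf : ∀ s t, ¬ G.Adj (g (.inr s)) (g (.inr t)) := by
      intro s t h
      have hp := hpend t
      rcases s with a | a
      · rw [hAadj] at h
        exact hnp 1 (by omega) (by omega) (h ▸ hp)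
      · rw [hCadj] at h
        exact hnp (m - 1) (by omega) (by omega) (h ▸ hp)
    rintro (i | s) (j | t)
    · rw [hg1, hg1, hadj _ _ (by omega) (by omega)]
      simp only [doubleBroom, fromRel_adj, pathGraph_adj, ne_eq, Sum.inl.injEq, Fin.ext_iff]
      omega
    · rcases t with a | a
      · rw [G.adj_comm, hAadj, hg1, hf1]
        simp [doubleBroom]
      · rw [G.adj_comm, hCadj, hg1, hfm1]
        simp [doubleBroom]
    · rcases s with a | a
      · rw [hAadj, hg1, hf1]
        simp [doubleBroom]
      · rw [hCadj, hg1, hfm1]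
        simp [doubleBroom]
    · refine iff_of_false (hlf s t) ?_
      simp [doubleBroom]
  have hA : Nonempty A := ⟨⟨u, hpu, hf0 ▸ (hadj 0 1 (by omega) (by omega)).2 (by omega)⟩⟩
  have hC : Nonempty C :=
    ⟨⟨v, hpv, by
      have := (hadj m (m - 1) le_rfl (by omega)).2 (by omega)
      rwa [hfm] at this⟩⟩
  refine ⟨m - 1, Nat.card A, Nat.card C, by omega, Nat.card_pos, Nat.card_pos, hcount.symm,
    by rw [hcount, hcard], ⟨Iso.symm ⟨Equiv.ofBijective g ⟨hginj, hgsurj⟩, ?_⟩⟩⟩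
  intro s t
  exact hiso s t

end SimpleGraph

/-! ### The extremal graphs -/

open SimpleGraph in
/-- A connected graph maximizing the distance signless Laplacian spectral radius among the
connected graphs with at least `k` pendant vertices has exactly `k` pendant vertices and is a
double broom. -/
theorem doubleBroom_of_forall_spectralRadius_le {n k : ℕ} (hk : 2 ≤ k) (hkn : k + 2 ≤ n)
    {G : SimpleGraph (Fin n)} (hG : G.Connected) (hGk : k ≤ {v | IsPendantVertex G v}.ncard)
    (hmax : ∀ H : SimpleGraph (Fin n), H.Connected → k ≤ {v | IsPendantVertex H v}.ncard →
      distanceSignlessLaplacianSpectralRadius H ≤ distanceSignlessLaplacianSpectralRadius G) :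
    {v | IsPendantVertex G v}.ncard = k ∧ G ∈ doubleBroomClass n k := by
  have : Nontrivial (Fin n) := Fin.nontrivial_iff_two_le.2 (by omega)
  have htree : G.IsTree := by
    refine ⟨hG, isAcyclic_iff_forall_adj_isBridge.2 fun u v huv => ?_⟩
    by_contra hbr
    have hH := hG.connected_delete_edge_of_not_isBridge hbr
    have hle := G.deleteEdges_le {s(u, v)}
    have hdist : ∀ a b, G.dist a b ≤ (G.deleteEdges {s(u, v)}).dist a b := fun a b =>
      (hH a b).dist_anti hle
    have hlt : G.dist u v < (G.deleteEdges {s(u, v)}).dist u v := by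
      rw [dist_eq_one_iff_adj.2 huv]
      exact hH.one_lt_dist_of_ne_of_not_adj huv.ne (by simp)
    have hρ := or_self_iff.1 (spectralRadius_lt_or_lt_of_dist hG
      (H := G.deleteEdges {s(u, v)}) (K := G.deleteEdges {s(u, v)})
      (fun a b => by have := hdist a b; omega) ⟨u, v, by omega⟩)
    refine hρ.not_ge (hmax _ hH (hGk.trans (Set.ncard_le_ncard ?_)))
    exact fun z hz => isPendantVertex_deleteEdges hH hz
  have hmove : ∀ w b c d, G.Adj w b → G.Adj w c → G.Adj w d → b ≠ c → b ≠ d → c ≠ d →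
      {v | IsPendantVertex G v}.ncard = k ∧ (IsPendantVertex G c ∨ IsPendantVertex G d) := by
    intro w b c d hb hc hd hbc hbd hcd
    have hρ := spectralRadius_lt_or_lt_of_dist hG
      (htree.two_mul_dist_le_moveEdge hb hc hd hbc hbd hcd)
      ⟨w, b, htree.two_mul_dist_lt_moveEdge hb hc hd hbc hbd⟩
    have key : ∀ c d, G.Adj w c → G.Adj w d → b ≠ c → c ≠ d →
        distanceSignlessLaplacianSpectralRadius G
          < distanceSignlessLaplacianSpectralRadius (G.moveEdge w b c) →
        {v | IsPendantVertex G v}.ncard = k ∧ IsPendantVertex G c := by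
      intro c d hc hd hbc hcd hlt
      have hsub : {v | IsPendantVertex G v} \ {c} ⊆ {v | IsPendantVertex (G.moveEdge w b c) v} :=
        fun z hz => isPendantVertex_moveEdge hb hc hd hbc hcd hz.1 hz.2
      have hcard := Set.ncard_le_ncard hsub
      -- The moved graph beats `G`, so it lies outside the relaxed class; at most the vertex `c` was
      -- lost.
      have hnot : ¬ k ≤ {v | IsPendantVertex (G.moveEdge w b c) v}.ncard := fun h =>
        hlt.not_ge (hmax _ (hG.moveEdge hc hbc) h)
      by_cases hpc : IsPendantVertex G c
      · rw [Set.ncard_sdiff_singleton_of_mem (by exact hpc)] at hcard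
        exact ⟨by omega, hpc⟩
      · rw [Set.sdiff_singleton_eq_self (by exact hpc)] at hcard
        exact absurd (hGk.trans hcard) hnot
    rcases hρ with h | h
    · have := key c d hc hd hbc hcd h
      exact ⟨this.1, Or.inl this.2⟩
    · have := key d c hd hc hbd hcd.symm h
      exact ⟨this.1, Or.inr this.2⟩
  have hcount : {v | IsPendantVertex G v}.ncard = k := by
    by_contra hne
    have := htree.ncard_isPendantVertex_le_two fun w a b c ha hb hc => by
      by_contra! hcon
      exact hne (hmove w a b c ha hb hc hcon.1 hcon.2.1 hcon.2.2).1
    omega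
  refine ⟨hcount, ?_⟩
  -- There are `n - k ≥ 2` vertices that are not pendant.
  have hcompl := Set.ncard_add_ncard_compl {v | IsPendantVertex G v}
  rw [hcount, Nat.card_fin] at hcompl
  obtain ⟨x, y, hx, hy, hxy⟩ := (Set.one_lt_ncard_iff (Set.toFinite _)).1
    (show 1 < {v | IsPendantVertex G v}ᶜ.ncard by omega)
  obtain ⟨ℓ, t₁, t₂, h1, h2, h3, h4, h5, h6⟩ := htree.exists_iso_doubleBroom
    (fun w b c d hb hc hd hbc hbd hcd => (hmove w b c d hb hc hd hbc hbd hcd).2) hxy hx hy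
  rw [hcount] at h4 h5
  exact ⟨ℓ, t₁, t₂, h1, h2, h3, h4, by simpa using h5, h6⟩

/-- The star qualifies: its `n - 1` leaves suffice because the relaxed class only asks for at least
`k`. -/
theorem exists_connected_le_ncard_isPendantVertex {n k : ℕ} (hkn : k + 2 ≤ n) :
    ∃ G : SimpleGraph (Fin n), G.Connected ∧ k ≤ {v | IsPendantVertex G v}.ncard := by
  have : NeZero n := ⟨by omega⟩
  refine ⟨SimpleGraph.starGraph 0, SimpleGraph.connected_starGraph 0, ?_⟩
  have hsub : ({0} : Set (Fin n))ᶜ ⊆ {v | IsPendantVertex (SimpleGraph.starGraph 0) v} :=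
    fun v hv => (isPendantVertex_iff_degree_eq_one _ v).2
      (SimpleGraph.degree_starGraph_of_ne_center hv)
  have h1 := Set.ncard_le_ncard hsub
  have h2 := Set.ncard_add_ncard_compl ({0} : Set (Fin n))
  rw [Set.ncard_singleton, Nat.card_fin] at h2
  omega

theorem theorem3p5 (n k : ℕ) (hk : 2 ≤ k) (hkn : k + 2 ≤ n) :
    (∃ G ∈ connectedGraphsWithPendant n k, ∀ H ∈ connectedGraphsWithPendant n k,
      distanceSignlessLaplacianSpectralRadius H ≤ distanceSignlessLaplacianSpectralRadius G) ∧
    ∀ G ∈ connectedGraphsWithPendant n k,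
      (∀ H ∈ connectedGraphsWithPendant n k,
        distanceSignlessLaplacianSpectralRadius H ≤ distanceSignlessLaplacianSpectralRadius G) →
      G ∈ doubleBroomClass n k := by
  -- A maximiser `M` of the relaxed problem has exactly `k` pendant vertices, so both problems have
  -- the same maximum.
  obtain ⟨M, ⟨hM, hMk⟩, hmax⟩ := Set.exists_max_image
    {G : SimpleGraph (Fin n) | G.Connected ∧ k ≤ {v | IsPendantVertex G v}.ncard}
    distanceSignlessLaplacianSpectralRadius (Set.toFinite _)
    (exists_connected_le_ncard_isPendantVertex hkn)
  have hMc := (doubleBroom_of_forall_spectralRadius_le hk hkn hM hMk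
    fun H hH hHk => hmax H ⟨hH, hHk⟩).1
  refine ⟨⟨M, ⟨hM, hMc⟩, fun H hH => hmax H ⟨hH.1, hH.2.ge⟩⟩, fun G hG hGmax => ?_⟩
  exact (doubleBroom_of_forall_spectralRadius_le hk hkn hG.1 hG.2.ge
    fun H hH hHk => (hmax H ⟨hH, hHk⟩).trans (hGmax M ⟨hM, hMc⟩)).2
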